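/- Let $S=\mathbb{C}[x_1,x_2,x_3]$, and let $h_m$ and $e_m$ denote the complete homogeneous and the elementary symmetric polynomials of degree $m$ in $x_1,x_2,x_3$. Let $n>3$ be an integer. Then, modulo the ideal $(h_2,h_3)$ of $S$, \[ h_n\equiv\begin{cases} e_1^{2k-2}e_2^{k+1} & \text{if } n=4k,\\ e_1^{2k-1}e_2^{k+1} & \text{if } n=4k+1,\\ 0 & \text{if } n=4k+2 \text{ or } n=4k+3,\end{cases} \] where $k$ is a positive integer. Moreover, $h_2,h_3,h_n$ is a regular sequence on $S$ if and only if $n\equiv 0$ or $1 \pmod 4$. Here $f_1,\dots,f_r\in S$ is a regular sequence on $S$ if the ideal $(f_1,\dots,f_r)$ is proper and, for each $0\le i<r$, the image of $f_{i+1}$ is a nonzerodivisor in $S/(f_1,\dots,f_i)$. -/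

import Mathlib

open MvPolynomial

/-!
Let `S = R[x₀, x₁, x₂]`, `s = e₁` and `I = (h₂, h₃)`. Since `h₂ = e₁² - e₂` and `h₃ = e₁³ - 2e₁e₂ +
e₃`, modulo `I` one has `e₂ ≡ s²` and `e₃ ≡ s³`, so the recurrence `h_{n+3} = e₁h_{n+2} - e₂h_{n+1}
+ e₃h_n` (`hsymm_fin_three_add_three`) becomes `h_{n+4} ≡ s⁴h_n` (`mk_hsymm_add_four`). Starting
from `h₀ = 1`, `h₁ = s`, `h₂ ≡ h₃ ≡ 0`, this gives `h_n ≡ sⁿ` for `n ≡ 0, 1 mod 4` and `h_n ≡ 0`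
otherwise.

If `h_n ∈ I`, the sequence is not regular because `S / I ≠ 0`. In the other cases one must show that
`h₂`, `h₃`, `s` are successively nonzerodivisors when `R` is a domain. View `S` as `A[T]` with `A =
R[a, b]` and `T = x₀`, `a = x₁`, `b = x₂`. Then `h₂` is monic in `T`, and `h₃ = T h₂ + r` with `r =
h₃(a, b) ∈ A` nonzero. Division with remainder by the monic `h₂` shows that a nonzero constant is a
nonzerodivisor modulo `h₂` (`Polynomial.Monic.dvd_of_dvd_C_mul`), which settles `h₃`. It also shows
that a prime `b` of `A` not dividing `r` is a nonzerodivisor modulo `(h₂, r) = I`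
(`Polynomial.Monic.mem_span_pair_of_C_mul_mem`). Finally, `x₂` is a root of `(t - x₀)(t - x₁)(t -
x₂) = t³ - e₁t² + e₂t - e₃ ≡ t³ - s(t² - st + s²)`, so `s` divides `x₂³` modulo `I` and is a
nonzerodivisor because `x₂` is.
-/

/-! ### Recurrences for complete homogeneous symmetric polynomials -/

namespace MvPolynomial

theorem hsymm_option_succ {σ R : Type*} [Fintype σ] [DecidableEq σ] [CommSemiring R] (n : ℕ) :
    hsymm (Option σ) R (n + 1) =
      X none * hsymm (Option σ) R n + rename some (hsymm σ R (n + 1)) := by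
  unfold hsymm
  rw [← (symOptionSuccEquiv (α := σ) (n := n)).symm.sum_comp, Fintype.sum_sum_type, map_sum,
    Finset.mul_sum]
  congr 1
  · refine Finset.sum_congr rfl fun s _ => ?_
    change ((SymOptionSuccEquiv.decode (Sum.inl s)).1.map X).prod = _
    rw [SymOptionSuccEquiv.decode_inl]
    change (Multiset.map X (none ::ₘ s.1)).prod = _
    simp
  · refine Finset.sum_congr rfl fun s _ => ?_
    change ((SymOptionSuccEquiv.decode (Sum.inr s)).1.map X).prod = _
    rw [SymOptionSuccEquiv.decode_inr]
    change (Multiset.map X (Multiset.map some s.1)).prod = _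
    rw [map_multiset_prod, Multiset.map_map, Multiset.map_map]
    simp [Function.comp_def]

/-- A monomial of degree `n + 1` either involves the variable `0` or is a monomial in the other
variables. -/
theorem hsymm_fin_succ_succ {R : Type*} [CommSemiring R] (m n : ℕ) :
    hsymm (Fin (m + 1)) R (n + 1) =
      X 0 * hsymm (Fin (m + 1)) R n + rename Fin.succ (hsymm (Fin m) R (n + 1)) := by
  have h := congrArg (rename (_root_.finSuccEquiv m).symm) (hsymm_option_succ (σ := Fin m) (R := R) n)
  rw [map_add, map_mul, rename_hsymm, rename_hsymm, rename_X, rename_rename] at h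
  simpa [Function.comp_def] using h

theorem hsymm_fin_zero_succ {R : Type*} [CommSemiring R] (n : ℕ) :
    hsymm (Fin 0) R (n + 1) = 0 := by
  simp [hsymm]

section FinThree

variable (R : Type*) [CommRing R]

theorem esymm_one_fin_three : esymm (Fin 3) R 1 = X 0 + X 1 + X 2 := by
  simp [esymm_one, Fin.sum_univ_three]

theorem esymm_two_fin_three :
    esymm (Fin 3) R 2 = X 0 * X 1 + X 0 * X 2 + X 1 * X 2 := by
  have h : Finset.powersetCard 2 (Finset.univ : Finset (Fin 3)) = {{0, 1}, {0, 2}, {1, 2}} := by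
    decide
  rw [esymm, h, Finset.sum_insert (by decide), Finset.sum_insert (by decide),
    Finset.sum_singleton, Finset.prod_pair (by decide), Finset.prod_pair (by decide),
    Finset.prod_pair (by decide), add_assoc]

theorem esymm_three_fin_three : esymm (Fin 3) R 3 = X 0 * X 1 * X 2 := by
  have h : Finset.powersetCard 3 (Finset.univ : Finset (Fin 3)) = {Finset.univ} := by decide
  rw [esymm, h, Finset.sum_singleton, Fin.prod_univ_three]

/-- Eliminating the variables `X 0` and `X 1` one after the other: on the one-variable
polynomials that remain, `hsymm` is multiplied by `X 2` at each step. -/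
theorem hsymm_fin_three_add_three (n : ℕ) :
    hsymm (Fin 3) R (n + 3) = esymm (Fin 3) R 1 * hsymm (Fin 3) R (n + 2) -
      esymm (Fin 3) R 2 * hsymm (Fin 3) R (n + 1) + esymm (Fin 3) R 3 * hsymm (Fin 3) R n := by
  have hA (k : ℕ) : rename Fin.succ (rename Fin.succ (hsymm (Fin 1) R (k + 1))) =
      (X 2 : MvPolynomial (Fin 3) R) * rename Fin.succ (rename Fin.succ (hsymm (Fin 1) R k)) := by
    rw [hsymm_fin_succ_succ, hsymm_fin_zero_succ]
    simp
  have hB (k : ℕ) : rename Fin.succ (hsymm (Fin 2) R (k + 1)) =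
      (X 1 : MvPolynomial (Fin 3) R) * rename Fin.succ (hsymm (Fin 2) R k) +
        rename Fin.succ (rename Fin.succ (hsymm (Fin 1) R (k + 1))) := by
    rw [hsymm_fin_succ_succ]
    simp
  have hC (k : ℕ) := hsymm_fin_succ_succ (R := R) 2 k
  rw [esymm_one_fin_three, esymm_two_fin_three, esymm_three_fin_three]
  linear_combination hC (n + 2) - (X 1 + X 2) * hC (n + 1) + X 1 * X 2 * hC n
    + hB (n + 2) - X 2 * hB (n + 1) + hA (n + 2)

theorem hsymm_two_fin_three :
    hsymm (Fin 3) R 2 = X 0 ^ 2 + (X 1 + X 2) * X 0 + (X 1 ^ 2 + X 1 * X 2 + X 2 ^ 2) := by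
  simp only [hsymm_fin_succ_succ, hsymm_fin_zero_succ, hsymm_zero, map_add, map_mul, map_one,
    rename_X, map_zero]
  simp
  ring

theorem hsymm_three_fin_three :
    hsymm (Fin 3) R 3 =
      X 0 * hsymm (Fin 3) R 2 + (X 1 ^ 3 + X 1 ^ 2 * X 2 + X 1 * X 2 ^ 2 + X 2 ^ 3) := by
  rw [hsymm_fin_succ_succ 2 2]
  simp only [hsymm_fin_succ_succ, hsymm_fin_zero_succ, hsymm_zero, map_add, map_mul, map_one,
    rename_X, map_zero]
  simp
  ring

end FinThree

end MvPolynomial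

/-! ### The residues of `hsymm` modulo `(h₂, h₃)` -/

section Residues

variable (R : Type*) [CommRing R]

/-- The ideal `(h₂, h₃)` of `R[x₀, x₁, x₂]`. -/
noncomputable abbrev hsymmIdeal : Ideal (MvPolynomial (Fin 3) R) :=
  Ideal.span {hsymm (Fin 3) R 2, hsymm (Fin 3) R 3}

local notation "π" => Ideal.Quotient.mk (hsymmIdeal R)

theorem mk_hsymm_two : π (hsymm (Fin 3) R 2) = 0 :=
  Ideal.Quotient.eq_zero_iff_mem.2 (Ideal.subset_span (by simp))

theorem mk_hsymm_three : π (hsymm (Fin 3) R 3) = 0 :=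
  Ideal.Quotient.eq_zero_iff_mem.2 (Ideal.subset_span (by simp))

theorem mk_esymm_two : π (esymm (Fin 3) R 2) = π (esymm (Fin 3) R 1) ^ 2 := by
  have h : esymm (Fin 3) R 1 ^ 2 - esymm (Fin 3) R 2 = hsymm (Fin 3) R 2 := by
    rw [esymm_one_fin_three, esymm_two_fin_three, hsymm_two_fin_three]
    ring
  have h' := congrArg π h
  rw [map_sub, map_pow, mk_hsymm_two] at h'
  exact (sub_eq_zero.1 h').symm

theorem mk_esymm_three : π (esymm (Fin 3) R 3) = π (esymm (Fin 3) R 1) ^ 3 := by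
  have h := congrArg π (hsymm_fin_three_add_three R 0)
  have h1 : hsymm (Fin 3) R (0 + 1) = esymm (Fin 3) R 1 := by
    rw [zero_add, hsymm_one, esymm_one]
  rw [h1, hsymm_zero, map_add, map_sub, map_mul, map_mul, mul_one, zero_add, zero_add,
    mk_hsymm_two, mk_hsymm_three, mk_esymm_two] at h
  linear_combination -h

theorem mk_hsymm_add_four (n : ℕ) :
    π (hsymm (Fin 3) R (n + 4)) = π (esymm (Fin 3) R 1) ^ 4 * π (hsymm (Fin 3) R n) := by
  have h (m : ℕ) := congrArg π (hsymm_fin_three_add_three R m)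
  simp only [map_add, map_sub, map_mul, mk_esymm_two, mk_esymm_three] at h
  -- `(1 + st)(1 - st + s²t² - s³t³) = 1 - s⁴t⁴`.
  linear_combination h (n + 1) + π (esymm (Fin 3) R 1) * h n

theorem mk_hsymm_four_mul (k : ℕ) :
    π (hsymm (Fin 3) R (4 * k)) = π (esymm (Fin 3) R 1) ^ (4 * k) := by
  induction k with
  | zero => simp
  | succ k ih => rw [mul_add, mul_one, mk_hsymm_add_four, ih, pow_add, mul_comm]

theorem mk_hsymm_four_mul_add_one (k : ℕ) :
    π (hsymm (Fin 3) R (4 * k + 1)) = π (esymm (Fin 3) R 1) ^ (4 * k + 1) := by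
  induction k with
  | zero => simp [hsymm_one, esymm_one]
  | succ k ih =>
    rw [show 4 * (k + 1) + 1 = 4 * k + 1 + 4 by ring, mk_hsymm_add_four, ih,
      pow_add _ (4 * k + 1), mul_comm]

theorem hsymm_four_mul_add_two_mem (k : ℕ) : hsymm (Fin 3) R (4 * k + 2) ∈ hsymmIdeal R := by
  rw [← Ideal.Quotient.eq_zero_iff_mem]
  induction k with
  | zero => exact mk_hsymm_two R
  | succ k ih =>
    rw [show 4 * (k + 1) + 2 = 4 * k + 2 + 4 by ring, mk_hsymm_add_four, ih, mul_zero]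

theorem hsymm_four_mul_add_three_mem (k : ℕ) : hsymm (Fin 3) R (4 * k + 3) ∈ hsymmIdeal R := by
  rw [← Ideal.Quotient.eq_zero_iff_mem]
  induction k with
  | zero => exact mk_hsymm_three R
  | succ k ih =>
    rw [show 4 * (k + 1) + 3 = 4 * k + 3 + 4 by ring, mk_hsymm_add_four, ih, mul_zero]

end Residues

/-! ### Nonzerodivisors modulo a monic polynomial -/

namespace Polynomial

variable {A : Type*} [CommRing A]

theorem C_mul_modByMonic (r : A) (p g : A[X]) : (C r * p) %ₘ g = C r * (p %ₘ g) := by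
  rw [← smul_eq_C_mul, smul_modByMonic, smul_eq_C_mul]

variable [IsDomain A]

theorem Monic.dvd_of_dvd_C_mul {g p : A[X]} (hg : g.Monic) {r : A} (hr : r ≠ 0)
    (h : g ∣ C r * p) : g ∣ p := by
  rw [← modByMonic_eq_zero_iff_dvd hg] at h ⊢
  rw [C_mul_modByMonic] at h
  exact (mul_eq_zero.1 h).resolve_left (C_ne_zero.2 hr)

/-- Comparing remainders modulo `g` reduces the claim to `A`, where it says that the prime `b` is
a nonzerodivisor modulo `r`. -/
theorem Monic.mem_span_pair_of_C_mul_mem {g p : A[X]} (hg : g.Monic) {b r : A} (hb : Prime b)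
    (hbr : ¬ b ∣ r) (h : C b * p ∈ Ideal.span {g, C r}) : p ∈ Ideal.span {g, C r} := by
  obtain ⟨u, v, huv⟩ := Ideal.mem_span_pair.1 h
  have hrem : C r * (v %ₘ g) = C b * (p %ₘ g) := by
    rw [← C_mul_modByMonic, ← C_mul_modByMonic, ← huv, add_modByMonic,
      (modByMonic_eq_zero_iff_dvd hg).2 (dvd_mul_left g u), zero_add, mul_comm]
  have hbC : Prime (C b) := prime_C_iff.2 hb
  obtain ⟨w, hw⟩ : C b ∣ v %ₘ g := by
    refine (hbC.dvd_or_dvd ⟨_, hrem⟩).resolve_left fun hd => hbr ?_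
    simpa using (C_dvd_iff_dvd_coeff b (C r)).1 hd 0
  have hp : p %ₘ g = C r * w := by
    apply mul_left_cancel₀ hbC.ne_zero
    rw [← hrem, hw]
    ring
  rw [Ideal.mem_span_pair]
  refine ⟨p /ₘ g, w, ?_⟩
  rw [mul_comm w, ← hp, mul_comm, add_comm]
  exact modByMonic_add_div p g

end Polynomial

/-! ### Regularity of `h₂`, `h₃`, `hₙ` -/

section Regularity

variable (R : Type*) [CommRing R]

/-- `h₂(T, a, b)` as a polynomial in `T = x₀` over `R[a, b]`. -/
noncomputable def hsymmTwoPoly : Polynomial (MvPolynomial (Fin 2) R) :=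
  Polynomial.X ^ 2 + Polynomial.C (X 0 + X 1) * Polynomial.X +
    Polynomial.C (X 0 ^ 2 + X 0 * X 1 + X 1 ^ 2)

/-- `h₃(a, b)`, the remainder of `h₃(T, a, b)` modulo `h₂(T, a, b)`. -/
noncomputable def hsymmThreeRem : MvPolynomial (Fin 2) R :=
  X 0 ^ 3 + X 0 ^ 2 * X 1 + X 0 * X 1 ^ 2 + X 1 ^ 3

theorem finSuccEquiv_X_one : finSuccEquiv R 2 (X 1) = Polynomial.C (X 0) :=
  finSuccEquiv_X_succ (j := 0)

theorem finSuccEquiv_X_two : finSuccEquiv R 2 (X 2) = Polynomial.C (X 1) :=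
  finSuccEquiv_X_succ (j := 1)

theorem finSuccEquiv_hsymm_two :
    finSuccEquiv R 2 (hsymm (Fin 3) R 2) = hsymmTwoPoly R := by
  simp [hsymm_two_fin_three, hsymmTwoPoly, finSuccEquiv_X_zero, finSuccEquiv_X_one,
    finSuccEquiv_X_two]

theorem finSuccEquiv_hsymm_three :
    finSuccEquiv R 2 (hsymm (Fin 3) R 3) =
      Polynomial.X * hsymmTwoPoly R + Polynomial.C (hsymmThreeRem R) := by
  rw [hsymm_three_fin_three, map_add, map_mul, finSuccEquiv_hsymm_two]
  simp [hsymmThreeRem, finSuccEquiv_X_zero, finSuccEquiv_X_one, finSuccEquiv_X_two]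

theorem monic_hsymmTwoPoly [Nontrivial R] : (hsymmTwoPoly R).Monic := by
  unfold hsymmTwoPoly
  monicity!

theorem not_X_one_dvd_hsymmThreeRem [Nontrivial R] :
    ¬ (X 1 : MvPolynomial (Fin 2) R) ∣ hsymmThreeRem R := by
  rintro ⟨q, hq⟩
  simpa [hsymmThreeRem] using congrArg (eval ![1, 0]) hq

theorem map_hsymmIdeal :
    (hsymmIdeal R).map (finSuccEquiv R 2) =
      Ideal.span {hsymmTwoPoly R, Polynomial.C (hsymmThreeRem R)} := by
  rw [Ideal.map_span, Set.image_pair]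
  rw [finSuccEquiv_hsymm_two, finSuccEquiv_hsymm_three, add_comm,
    Ideal.span_pair_add_mul_left]

theorem mem_hsymmIdeal_iff (p : MvPolynomial (Fin 3) R) :
    p ∈ hsymmIdeal R ↔
      finSuccEquiv R 2 p ∈ Ideal.span {hsymmTwoPoly R, Polynomial.C (hsymmThreeRem R)} := by
  rw [← map_hsymmIdeal, Ideal.mem_map_of_equiv]
  exact ⟨fun h => ⟨p, h, rfl⟩, fun ⟨_, hq, h⟩ => (finSuccEquiv R 2).injective h ▸ hq⟩

theorem hsymm_two_ne_zero [Nontrivial R] : hsymm (Fin 3) R 2 ≠ 0 := by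
  intro h
  apply (monic_hsymmTwoPoly R).ne_zero
  rw [← finSuccEquiv_hsymm_two, h, map_zero]

theorem constantCoeff_hsymm {σ : Type*} [Fintype σ] [DecidableEq σ] {n : ℕ} (hn : n ≠ 0) :
    constantCoeff (hsymm σ R n) = 0 := by
  rw [hsymm, map_sum]
  refine Finset.sum_eq_zero fun s _ => ?_
  rw [map_multiset_prod, Multiset.map_map]
  simp [Function.comp_def, hn]

theorem span_hsymm_ne_top [Nontrivial R] {n : ℕ} (hn : n ≠ 0) :
    Ideal.span {hsymm (Fin 3) R 2, hsymm (Fin 3) R 3, hsymm (Fin 3) R n} ≠ ⊤ := by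
  intro h
  have hle : Ideal.span {hsymm (Fin 3) R 2, hsymm (Fin 3) R 3, hsymm (Fin 3) R n} ≤
      RingHom.ker (constantCoeff (R := R) (σ := Fin 3)) := by
    rw [Ideal.span_le]
    rintro _ (rfl | rfl | rfl)
    · exact constantCoeff_hsymm R two_ne_zero
    · exact constantCoeff_hsymm R three_ne_zero
    · exact constantCoeff_hsymm R hn
  exact RingHom.ker_ne_top _ (top_le_iff.1 (h ▸ hle))

variable [IsDomain R]

theorem hsymm_two_dvd_of_dvd_hsymm_three_mul {p : MvPolynomial (Fin 3) R}
    (h : hsymm (Fin 3) R 2 ∣ hsymm (Fin 3) R 3 * p) : hsymm (Fin 3) R 2 ∣ p := by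
  rw [← map_dvd_iff (finSuccEquiv R 2), finSuccEquiv_hsymm_two] at h ⊢
  rw [map_mul, finSuccEquiv_hsymm_three, add_mul, mul_right_comm,
    dvd_add_right (dvd_mul_left _ _)] at h
  refine (monic_hsymmTwoPoly R).dvd_of_dvd_C_mul (fun h0 => ?_) h
  exact not_X_one_dvd_hsymmThreeRem R (h0 ▸ dvd_zero _)

theorem mem_hsymmIdeal_of_X_two_mul_mem {p : MvPolynomial (Fin 3) R}
    (h : X 2 * p ∈ hsymmIdeal R) : p ∈ hsymmIdeal R := by
  rw [mem_hsymmIdeal_iff] at h ⊢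
  rw [map_mul, finSuccEquiv_X_two] at h
  exact (monic_hsymmTwoPoly R).mem_span_pair_of_C_mul_mem X_prime
    (not_X_one_dvd_hsymmThreeRem R) h

theorem mem_hsymmIdeal_of_esymm_one_mul_mem {p : MvPolynomial (Fin 3) R}
    (h : esymm (Fin 3) R 1 * p ∈ hsymmIdeal R) : p ∈ hsymmIdeal R := by
  have hroot : (X 2 : MvPolynomial (Fin 3) R) ^ 3 - esymm (Fin 3) R 1 * X 2 ^ 2 +
      esymm (Fin 3) R 2 * X 2 - esymm (Fin 3) R 3 = 0 := by
    rw [esymm_one_fin_three, esymm_two_fin_three, esymm_three_fin_three]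
    ring
  have hX : X 2 * (X 2 * (X 2 * p)) ∈ hsymmIdeal R := by
    rw [← Ideal.Quotient.eq_zero_iff_mem] at h ⊢
    have hroot' := congrArg (Ideal.Quotient.mk (hsymmIdeal R)) hroot
    simp only [map_add, map_sub, map_mul, map_pow, map_zero, mk_esymm_two, mk_esymm_three]
      at h hroot' ⊢
    set π := Ideal.Quotient.mk (hsymmIdeal R)
    linear_combination π p * hroot' +
      (π (X 2) ^ 2 - π (esymm (Fin 3) R 1) * π (X 2) + π (esymm (Fin 3) R 1) ^ 2) * h
  exact mem_hsymmIdeal_of_X_two_mul_mem R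
    (mem_hsymmIdeal_of_X_two_mul_mem R (mem_hsymmIdeal_of_X_two_mul_mem R hX))

theorem mem_hsymmIdeal_of_esymm_one_pow_mul_mem (m : ℕ) {p : MvPolynomial (Fin 3) R}
    (h : esymm (Fin 3) R 1 ^ m * p ∈ hsymmIdeal R) : p ∈ hsymmIdeal R := by
  induction m with
  | zero => simpa using h
  | succ m ih =>
    rw [pow_succ', mul_assoc] at h
    exact ih (mem_hsymmIdeal_of_esymm_one_mul_mem R h)

/-- Nothing but the third element can obstruct regularity: `h₂` is a nonzerodivisor, and `h₃` is
one modulo `h₂`. -/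
theorem isRegular_hsymm_iff {n : ℕ} (hn : n ≠ 0) :
    RingTheory.Sequence.IsRegular (MvPolynomial (Fin 3) R)
        [hsymm (Fin 3) R 2, hsymm (Fin 3) R 3, hsymm (Fin 3) R n] ↔
      ∀ p, hsymm (Fin 3) R n * p ∈ hsymmIdeal R → p ∈ hsymmIdeal R := by
  have hI : (Ideal.ofList [hsymm (Fin 3) R 2, hsymm (Fin 3) R 3] •
      (⊤ : Submodule (MvPolynomial (Fin 3) R) (MvPolynomial (Fin 3) R))) = hsymmIdeal R := by
    simp [Ideal.span_insert, Ideal.ofList_cons]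
  constructor
  · intro h p hp
    have h2 := h.regular_mod_prev 2 (by simp)
    rw [isSMulRegular_quotient_iff_mem_of_smul_mem] at h2
    simp only [List.take_succ_cons, List.take_zero, hI] at h2
    exact h2 p hp
  · intro h
    refine ⟨⟨fun i hi => ?_⟩, ?_⟩
    · rw [isSMulRegular_quotient_iff_mem_of_smul_mem]
      intro p hp
      match i, hi with
      | 0, _ =>
        simp at hp ⊢
        exact hp.resolve_left (hsymm_two_ne_zero R)
      | 1, _ =>
        simp [Ideal.mem_span_singleton] at hp ⊢
        exact hsymm_two_dvd_of_dvd_hsymm_three_mul R hp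
      | 2, _ =>
        simp only [List.take_succ_cons, List.take_zero, hI] at hp ⊢
        exact h p hp
    · intro htop
      apply span_hsymm_ne_top R hn
      simpa [Ideal.span_insert, Ideal.ofList_cons] using htop.symm

/-- If `hₙ` lies in `(h₂, h₃)`, regularity would force this proper ideal to contain `1`. -/
theorem not_isRegular_hsymm_of_mem {n : ℕ} (hn : n ≠ 0) (h : hsymm (Fin 3) R n ∈ hsymmIdeal R) :
    ¬ RingTheory.Sequence.IsRegular (MvPolynomial (Fin 3) R)
        [hsymm (Fin 3) R 2, hsymm (Fin 3) R 3, hsymm (Fin 3) R n] := by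
  intro hreg
  have h1 : (1 : MvPolynomial (Fin 3) R) ∈ hsymmIdeal R :=
    (isRegular_hsymm_iff R hn).1 hreg 1 (by rwa [mul_one])
  refine span_hsymm_ne_top R hn ((Ideal.eq_top_iff_one _).2 (Ideal.span_mono ?_ h1))
  rintro _ (rfl | rfl) <;> simp

theorem isRegular_hsymm_of_mk_eq_pow {n : ℕ} (hn : n ≠ 0)
    (h : Ideal.Quotient.mk (hsymmIdeal R) (hsymm (Fin 3) R n) =
      Ideal.Quotient.mk (hsymmIdeal R) (esymm (Fin 3) R 1) ^ n) :
    RingTheory.Sequence.IsRegular (MvPolynomial (Fin 3) R)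
        [hsymm (Fin 3) R 2, hsymm (Fin 3) R 3, hsymm (Fin 3) R n] := by
  rw [isRegular_hsymm_iff R hn]
  intro p hp
  apply mem_hsymmIdeal_of_esymm_one_pow_mul_mem R n
  rwa [← Ideal.Quotient.eq_zero_iff_mem, map_mul, map_pow, ← h, ← map_mul,
    Ideal.Quotient.eq_zero_iff_mem]

end Regularity

theorem mainTheorem8 (n : ℕ) (hn : 3 < n) :
    (∀ k : ℕ, n = 4 * k →
      hsymm (Fin 3) ℂ n - esymm (Fin 3) ℂ 1 ^ (2 * k - 2) * esymm (Fin 3) ℂ 2 ^ (k + 1) ∈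
        Ideal.span {hsymm (Fin 3) ℂ 2, hsymm (Fin 3) ℂ 3}) ∧
    (∀ k : ℕ, n = 4 * k + 1 →
      hsymm (Fin 3) ℂ n - esymm (Fin 3) ℂ 1 ^ (2 * k - 1) * esymm (Fin 3) ℂ 2 ^ (k + 1) ∈
        Ideal.span {hsymm (Fin 3) ℂ 2, hsymm (Fin 3) ℂ 3}) ∧
    (∀ k : ℕ, n = 4 * k + 2 ∨ n = 4 * k + 3 →
      hsymm (Fin 3) ℂ n ∈ Ideal.span {hsymm (Fin 3) ℂ 2, hsymm (Fin 3) ℂ 3}) ∧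
    (RingTheory.Sequence.IsRegular (MvPolynomial (Fin 3) ℂ)
        [hsymm (Fin 3) ℂ 2, hsymm (Fin 3) ℂ 3, hsymm (Fin 3) ℂ n] ↔
      n ≡ 0 [MOD 4] ∨ n ≡ 1 [MOD 4]) := by
  have hn0 : n ≠ 0 := by omega
  refine ⟨?_, ?_, ?_, ?_⟩
  · rintro k rfl
    rw [← Ideal.Quotient.eq_zero_iff_mem, map_sub, map_mul, map_pow, map_pow, mk_hsymm_four_mul,
      mk_esymm_two, ← pow_mul, ← pow_add, show 2 * k - 2 + 2 * (k + 1) = 4 * k by omega, sub_self]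
  · rintro k rfl
    rw [← Ideal.Quotient.eq_zero_iff_mem, map_sub, map_mul, map_pow, map_pow,
      mk_hsymm_four_mul_add_one, mk_esymm_two, ← pow_mul, ← pow_add,
      show 2 * k - 1 + 2 * (k + 1) = 4 * k + 1 by omega, sub_self]
  · rintro k (rfl | rfl)
    · exact hsymm_four_mul_add_two_mem ℂ k
    · exact hsymm_four_mul_add_three_mem ℂ k
  · obtain ⟨k, rfl | rfl | rfl | rfl⟩ :
        ∃ k, n = 4 * k ∨ n = 4 * k + 1 ∨ n = 4 * k + 2 ∨ n = 4 * k + 3 :=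
      ⟨n / 4, by omega⟩
    · exact iff_of_true (isRegular_hsymm_of_mk_eq_pow ℂ hn0 (mk_hsymm_four_mul ℂ k))
        (by simp only [Nat.ModEq]; omega)
    · exact iff_of_true (isRegular_hsymm_of_mk_eq_pow ℂ hn0 (mk_hsymm_four_mul_add_one ℂ k))
        (by simp only [Nat.ModEq]; omega)
    · exact iff_of_false (not_isRegular_hsymm_of_mem ℂ hn0 (hsymm_four_mul_add_two_mem ℂ k))
        (by simp only [Nat.ModEq]; omega)
    · exact iff_of_false (not_isRegular_hsymm_of_mem ℂ hn0 (hsymm_four_mul_add_three_mem ℂ k))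
        (by simp only [Nat.ModEq]; omega)
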